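/- Let $\mathcal C$ be a triangulated category with suspension $[1]$. For a $t$-structure $\mathcal E=(\mathcal E^{\le 0},\mathcal E^{\ge 0})$ on $\mathcal C$ put $\mathcal E^{\le m}=\mathcal E^{\le 0}[-m]$, $\mathcal E^{\ge m}=\mathcal E^{\ge 0}[-m]$, $\mathcal E^{[a,b]}=\mathcal E^{\ge a}\cap\mathcal E^{\le b}$, let $\mathcal H_{\mathcal E}=\mathcal E^{[0,0]}$ be its heart, and let $H^i_{\mathcal E}(X)=\tau_{\mathcal E}^{\ge 0}\tau_{\mathcal E}^{\le 0}(X[i])$ be its cohomological functors, where $\tau_{\mathcal E}^{\le 0},\tau_{\mathcal E}^{\ge 0}$ are the truncation functors. Let $(\mathcal D,\mathcal T)$ be a pair of $t$-structures on $\mathcal C$ that is - right filterable: for every $i\in\mathbb Z$ the class $\mathcal D^{\ge i}\cap\mathcal T^{\ge 0}$ is a co-aisle, i.e. equals $\mathcal E^{\ge 0}$ for some $t$-structure $\mathcal E$ on $\mathcal C$; - of type $(n,0)$ with $n\in\mathbb N$: $0$ is the maximal integer $k$ with $\mathcal T^{\le k}\subseteq\mathcal D^{\le 0}$, and $n$ is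 the minimal natural number with $\mathcal D^{\le -n}\subseteq\mathcal T^{\le 0}$. For $i\in\mathbb Z$ let $\mathcal D_i$ be the $t$-structure with co-aisle $\mathcal D^{\ge -i}\cap\mathcal T^{\ge 0}$, let $\mathcal H_i$ be its heart, and let $(\mathcal X_i,\mathcal Y_i)=(\mathcal D_{i+1}^{\le 0}\cap\mathcal H_i,\ \mathcal D_{i+1}^{\ge 1}\cap\mathcal H_i)$, which is a torsion pair in $\mathcal H_i$. Given $X\in\mathcal H_{\mathcal D}$, its right $t$-tree consists of objects $X_{i_1\dots i_\ell}$ of $\mathcal C$, for $0\le\ell\le n$ and $i_1,\dots,i_\ell\in\{0,1\}$, with root $X$ (the vertex for $\ell=0$), and, for every $\ell<n$ and every vertex $X_{i_1\dots i_\ell}$, with $s=i_1+\dots+i_\ell$, a short exact sequence $$0\to X_{i_1\dots i_\ell 0}\to X_{i_1\dots i_\ell}\to X_{i_1\dots i_\ell 1}\to 0\quad\text{in }\mathcal H_\ell[-s]$$ with $X_{i_1\dots i_\ell 0}\in\mathcal X_\ell[-s]$ and $X_{i_1\dots i_\ell 1}\in\mathcal Y_\ell[-s]$. Such a tree exists and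 is unique up to isomorphism. **Proposition.** Let $X\in\mathcal H_{\mathcal D}$. For each $0\le\ell\le n$ and each vertex $X_{i_1\dots i_\ell}$ of the right $t$-tree of $X$, with $s=i_1+\dots+i_\ell$: 1. $X_{i_1\dots i_\ell}$ belongs to $\mathcal T^{[s,\,n-\ell+s]}$, and $\mathcal T^{[s,\,n-\ell+s]}\subseteq\mathcal T^{[0,n]}$; 2. $H^{s}_{\mathcal T}(X_{i_1\dots i_\ell})\cong X_{i_1\dots i_\ell\,0\cdots0}[s]$, with $n-\ell$ zeros appended; 3. $H^{n-\ell+s}_{\mathcal T}(X_{i_1\dots i_\ell})\cong X_{i_1\dots i_\ell\,1\cdots1}[n-\ell+s]$, with $n-\ell$ ones appended. -/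

import Mathlib

open CategoryTheory CategoryTheory.Limits CategoryTheory.Pretriangulated
  CategoryTheory.Triangulated

universe v u

namespace CategoryTheory.Triangulated.TStructure

section Definitions

variable {C : Type u} [Category.{v} C] [Preadditive C] [HasZeroObject C] [HasShift C ℤ]
  [∀ n : ℤ, (shiftFunctor C n).Additive] [Pretriangulated C]

/-- `D.interval a b` is the class `D^{[a,b]} = D^{≥ a} ∩ D^{≤ b}`. -/
def interval (D : TStructure C) (a b : ℤ) : ObjectProperty C := D.ge a ⊓ D.le b

/-- The cohomological functor `H^i_T`, given by `H^0_T = τ^{≥ 0} τ^{≤ 0}` and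
`H^i_T(X) = H^0_T(X[i])`. It is regarded as a functor to the ambient category; its values lie in
the heart of `T`, which is a full subcategory. -/
noncomputable def tCohomology (T : TStructure C) (i : ℤ) : C ⥤ C :=
  shiftFunctor C i ⋙ T.truncLE 0 ⋙ T.truncGE 0

/-- The pair `(D, T)` is of type `(n, k)`, i.e. has gap `n` and shift `k`: `k` is the maximal
integer with `T^{≤ k} ⊆ D^{≤ 0}`, and `n` is the minimal natural number with
`D^{≤ -n} ⊆ T^{≤ k}`. -/
def IsOfType (D T : TStructure C) (n : ℕ) (k : ℤ) : Prop :=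
  IsGreatest {j : ℤ | T.le j ≤ D.le 0} k ∧ IsLeast {m : ℕ | D.le (-(m : ℤ)) ≤ T.le k} n

/-- A class of objects is a co-aisle if it is the class `E^{≥ 0}` of some t-structure `E`. -/
def IsCoaisle (P : ObjectProperty C) : Prop := ∃ E : TStructure C, E.ge 0 = P

/-- The pair `(D, T)` is right filterable: each `D^{≥ i} ∩ T^{≥ 0}` is a co-aisle. -/
def RightFilterable (D T : TStructure C) : Prop :=
  ∀ i : ℤ, IsCoaisle (D.ge i ⊓ T.ge 0)

namespace RightFilterable

variable {D T : TStructure C} (h : D.RightFilterable T)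

/-- The right basic t-structure `D_i` of `(D, T)`: the t-structure with co-aisle
`D^{≥ -i} ∩ T^{≥ 0}` (a t-structure is determined by its co-aisle). -/
noncomputable def basic (i : ℤ) : TStructure C := (h (-i)).choose

lemma basic_ge_zero (i : ℤ) : (h.basic i).ge 0 = D.ge (-i) ⊓ T.ge 0 :=
  (h (-i)).choose_spec

/-- The right basic heart `H_i`. -/
noncomputable def basicHeart (i : ℤ) : ObjectProperty C := (h.basic i).heart

/-- The right basic torsion class `X_i = D_{i+1}^{≤ 0} ∩ H_i`. -/
noncomputable def torsionClass (i : ℤ) : ObjectProperty C :=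
  (h.basic (i + 1)).le 0 ⊓ h.basicHeart i

/-- The right basic torsion-free class `Y_i = D_{i+1}^{≥ 1} ∩ H_i`. -/
noncomputable def torsionFreeClass (i : ℤ) : ObjectProperty C :=
  (h.basic (i + 1)).ge 1 ⊓ h.basicHeart i

end RightFilterable

/-- `0 → X₁ → X₂ → X₃ → 0` is a short exact sequence in the full subcategory of `C` given
by `P`. -/
def ShortExactIn (P : ObjectProperty C) {X₁ X₂ X₃ : C} (f : X₁ ⟶ X₂) (g : X₂ ⟶ X₃) : Prop :=
  ∃ (h₁ : P X₁) (h₂ : P X₂) (h₃ : P X₃) (w : f ≫ g = 0),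
    (ShortComplex.mk (C := P.FullSubcategory) (X₁ := ⟨X₁, h₁⟩) (X₂ := ⟨X₂, h₂⟩) (X₃ := ⟨X₃, h₃⟩)
      (ObjectProperty.homMk f) (ObjectProperty.homMk g)
      (ObjectProperty.hom_ext P w)).ShortExact

/-- The degree `i₁ + ⋯ + i_ℓ` of a binary word `i₁ … i_ℓ`. -/
def wordDegree (w : List (Fin 2)) : ℤ := ((w.map Fin.val).sum : ℕ)

/-- A right t-tree of height `n` of the object `X`, for the right filterable pair `(D, T)`.
The vertices are indexed by the binary words `w = i₁ … i_ℓ` with `ℓ ≤ n` (the values of `vertex`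
at longer words are irrelevant), the root is `X`, and for `ℓ < n`, writing `s = i₁ + ⋯ + i_ℓ`,
`0 → X_{w0} → X_w → X_{w1} → 0` is the short exact sequence in `H_ℓ[-s]` that decomposes `X_w`
with respect to the torsion pair `(X_ℓ[-s], Y_ℓ[-s])`.
For a class `P` stable under isomorphisms, `P.shift s` is the class `P[-s]` of the
objects `Z` such that `Z[s]` is in `P`. -/
structure RightTTree {D T : TStructure C} (h : D.RightFilterable T) (n : ℕ) (X : C) where
  /-- the vertex `X_w` -/
  vertex : List (Fin 2) → C
  /-- the root is `X` -/
  root : vertex [] ≅ X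
  /-- the inclusion `X_{w0} ↪ X_w` -/
  incl (w : List (Fin 2)) (hw : w.length < n) : vertex (w ++ [0]) ⟶ vertex w
  /-- the projection `X_w ↠ X_{w1}` -/
  proj (w : List (Fin 2)) (hw : w.length < n) : vertex w ⟶ vertex (w ++ [1])
  shortExact (w : List (Fin 2)) (hw : w.length < n) :
    ShortExactIn ((h.basicHeart w.length).shift (wordDegree w)) (incl w hw) (proj w hw)
  torsion (w : List (Fin 2)) (hw : w.length < n) :
    (h.torsionClass w.length).shift (wordDegree w) (vertex (w ++ [0]))
  torsionFree (w : List (Fin 2)) (hw : w.length < n) :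
    (h.torsionFreeClass w.length).shift (wordDegree w) (vertex (w ++ [1]))

end Definitions

end CategoryTheory.Triangulated.TStructure

namespace CategoryTheory.Triangulated.TStructure

section Existence

variable {C : Type u} [Category.{v} C] [Preadditive C] [HasZeroObject C] [HasShift C ℤ]
  [∀ n : ℤ, (shiftFunctor C n).Additive] [Pretriangulated C]

lemma heart_shift_iff (E : TStructure C) (s : ℤ) (Y : C) :
    E.heart.shift s Y ↔ E.le s Y ∧ E.ge s Y := by
  rw [← E.shift_le s 0 s (by lia), ← E.shift_ge s 0 s (by lia)]
  rfl

lemma le_of_ge (E F : TStructure C) {a b : ℤ} (h : E.ge (a + 1) ≤ F.ge (b + 1)) :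
    F.le b ≤ E.le a := by
  intro Y hY
  rw [le_iff_isLE] at hY ⊢
  rw [E.isLE_iff_orthogonal a (a + 1) rfl]
  intro Z f hZ
  have : F.IsGE Z (b + 1) := ⟨h _ hZ.ge⟩
  exact F.zero f b (b + 1)

lemma RightFilterable.basic_ge {D T : TStructure C} (h : D.RightFilterable T) (i m : ℤ) :
    (h.basic i).ge m = D.ge (m - i) ⊓ T.ge m := by
  rw [← (h.basic i).shift_ge m 0 m (by lia), h.basic_ge_zero,
    ← D.shift_ge m (-i) (m - i) (by lia), ← T.shift_ge m 0 m (by lia)]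
  rfl

lemma shortExactIn_of_distTriang (E : TStructure C) (s : ℤ) {X₁ X₂ X₃ : C} (f : X₁ ⟶ X₂)
    (g : X₂ ⟶ X₃) (d : X₃ ⟶ X₁⟦(1 : ℤ)⟧) (hT : Triangle.mk f g d ∈ distTriang C)
    (h₁ : E.heart.shift s X₁) (h₂ : E.heart.shift s X₂) (h₃ : E.heart.shift s X₃) :
    ShortExactIn (E.heart.shift s) f g := by
  have w : f ≫ g = 0 := comp_distTriang_mor_zero₁₂ _ hT
  refine ⟨h₁, h₂, h₃, w, ?_⟩
  have hf : ∀ {Z : C} (_ : E.heart.shift s Z) (k k' : Z ⟶ X₁), k ≫ f = k' ≫ f → k = k' := by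
    intro Z hZ k k' e
    obtain ⟨l, hl⟩ := Triangle.coyoneda_exact₂ _ (inv_rot_of_distTriang _ hT) (k - k')
      ((Preadditive.sub_comp _ _ _).trans (sub_eq_zero.2 e))
    have : l = 0 := by
      have a1 : E.IsLE Z s := ⟨((heart_shift_iff E s Z).1 hZ).1⟩
      have a2 : E.IsGE X₃ s := ⟨((heart_shift_iff E s X₃).1 h₃).2⟩
      have := E.isGE_shift X₃ s (-1) (s + 1)
      exact E.zero (Y := X₃⟦(-1 : ℤ)⟧) l s (s + 1)
    rw [this, zero_comp] at hl
    exact sub_eq_zero.1 hl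
  have hg : ∀ {Z : C} (_ : E.heart.shift s Z) (k k' : X₃ ⟶ Z), g ≫ k = g ≫ k' → k = k' := by
    intro Z hZ k k' e
    obtain ⟨l, hl⟩ := Triangle.yoneda_exact₃ _ hT (k - k')
      ((Preadditive.comp_sub _ _ _).trans (sub_eq_zero.2 e))
    have : l = 0 := by
      have a1 : E.IsGE Z s := ⟨((heart_shift_iff E s Z).1 hZ).2⟩
      have a2 : E.IsLE X₁ s := ⟨((heart_shift_iff E s X₁).1 h₁).1⟩
      have := E.isLE_shift X₁ s 1 (s - 1)
      exact E.zero (X := X₁⟦(1 : ℤ)⟧) l (s - 1) s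
    rw [this, comp_zero] at hl
    exact sub_eq_zero.1 hl
  set S := ShortComplex.mk (C := (E.heart.shift s).FullSubcategory) (X₁ := ⟨X₁, h₁⟩)
    (X₂ := ⟨X₂, h₂⟩) (X₃ := ⟨X₃, h₃⟩) (ObjectProperty.homMk f) (ObjectProperty.homMk g)
      (ObjectProperty.hom_ext _ w) with hS
  have : (E.heart.shift s).ContainsZero := ⟨(HasZeroObject.zero' C).zero, isZero_zero C, by
    rw [heart_shift_iff]
    exact ⟨(E.isLE_of_isZero (isZero_zero C) s).le, (E.isGE_of_isZero (isZero_zero C) s).ge⟩⟩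
  have mf : Mono S.f := ⟨fun k k' e ↦ ObjectProperty.hom_ext _
    (hf (ObjectProperty.FullSubcategory.property _) _ _ (congrArg (fun z ↦ z.hom) e))⟩
  have eg : Epi S.g := ⟨fun k k' e ↦ ObjectProperty.hom_ext _
    (hg (ObjectProperty.FullSubcategory.property _) _ _ (congrArg (fun z ↦ z.hom) e))⟩
  have kf : ∀ {Z : (E.heart.shift s).FullSubcategory} (k : Z ⟶ S.X₂), k ≫ S.g = 0 →
      ∃ l : Z ⟶ S.X₁, l ≫ S.f = k := by
    intro Z k e
    obtain ⟨l, hl⟩ := Triangle.coyoneda_exact₂ _ hT k.hom (congrArg (fun z ↦ z.hom) e)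
    exact ⟨ObjectProperty.homMk l, ObjectProperty.hom_ext _ hl.symm⟩
  have cg : ∀ {Z : (E.heart.shift s).FullSubcategory} (k : S.X₂ ⟶ Z), S.f ≫ k = 0 →
      ∃ l : S.X₃ ⟶ Z, S.g ≫ l = k := by
    intro Z k e
    obtain ⟨l, hl⟩ := Triangle.yoneda_exact₂ _ hT k.hom (congrArg (fun z ↦ z.hom) e)
    exact ⟨ObjectProperty.homMk l, ObjectProperty.hom_ext _ hl.symm⟩
  have hk : IsLimit (KernelFork.ofι S.f S.zero) := KernelFork.IsLimit.ofι _ _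
    (fun k e ↦ (kf k e).choose) (fun k e ↦ (kf k e).choose_spec)
    (fun k e m hm ↦ by rw [← cancel_mono S.f, hm, (kf k e).choose_spec])
  have hc : IsColimit (CokernelCofork.ofπ S.g S.zero) := CokernelCofork.IsColimit.ofπ _ _
    (fun k e ↦ (cg k e).choose) (fun k e ↦ (cg k e).choose_spec)
    (fun k e m hm ↦ by rw [← cancel_epi S.g, hm, (cg k e).choose_spec])
  let Z : (E.heart.shift s).FullSubcategory :=
    (HasZeroObject.zero' _).zero
  have hZ : IsZero Z := isZero_zero _
  have e₁ : hk.lift (KernelFork.ofι S.f S.zero) = 𝟙 _ := by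
    rw [← cancel_mono S.f, Category.id_comp]
    exact hk.fac (KernelFork.ofι S.f S.zero) WalkingParallelPair.zero
  have e₂ : hc.desc (CokernelCofork.ofπ S.g S.zero) = 𝟙 _ := by
    rw [← cancel_epi S.g]
    refine Eq.trans ?_ (Category.comp_id S.g).symm
    exact hc.fac (CokernelCofork.ofπ S.g S.zero) WalkingParallelPair.one
  let L : S.LeftHomologyData :=
    { K := S.X₁, H := Z, i := S.f, π := 0, wi := S.zero, hi := hk, wπ := comp_zero
      hπ := CokernelCofork.IsColimit.ofEpiOfIsZero _ (by rw [e₁]; infer_instance) hZ }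
  let R : S.RightHomologyData :=
    { Q := S.X₃, H := Z, p := S.g, ι := 0, wp := S.zero, hp := hc, wι := zero_comp
      hι := KernelFork.IsLimit.ofMonoOfIsZero _ (by
        rw [e₂]
        exact inferInstanceAs (Mono (𝟙 S.X₃))) hZ }
  exact ⟨⟨⟨⟨L, R, Iso.refl _, by simp [L, R, S.zero]⟩, hZ⟩⟩⟩

/-- One step of the construction of the right t-tree: the decomposition of an object of
`H_i[-s]` with respect to the shifted torsion pair `(X_i[-s], Y_i[-s])`. -/
lemma RightFilterable.exists_decomposition {D T : TStructure C} (h : D.RightFilterable T)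
    (i s : ℤ) (Y : C) (hY : (h.basicHeart i).shift s Y) :
    ∃ (A B : C) (f : A ⟶ Y) (g : Y ⟶ B), ShortExactIn ((h.basicHeart i).shift s) f g ∧
      (h.torsionClass i).shift s A ∧ (h.torsionFreeClass i).shift s B ∧
      (h.basicHeart (i + 1)).shift s A ∧ (h.basicHeart (i + 1)).shift (s + 1) B := by
  set E := h.basic i with hE
  set F := h.basic (i + 1) with hF
  have i₁ : ∀ m, E.ge m ≤ F.ge m := fun m Z hZ ↦ by
    rw [hE, h.basic_ge] at hZ
    rw [hF, h.basic_ge]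
    exact ⟨D.ge_antitone (by lia) _ hZ.1, hZ.2⟩
  have i₂ : ∀ m, F.ge (m + 1) ≤ E.ge m := fun m Z hZ ↦ by
    rw [hF, h.basic_ge] at hZ
    rw [hE, h.basic_ge]
    exact ⟨D.ge_antitone (by lia) _ hZ.1, T.ge_antitone (by lia) _ hZ.2⟩
  have i₃ : ∀ m, F.le m ≤ E.le m := fun m ↦ le_of_ge E F (i₁ _)
  have i₄ : ∀ m, E.le m ≤ F.le (m + 1) := fun m ↦ le_of_ge F E (i₂ _)
  obtain ⟨A, B, hA, hB, f, g, d, hT⟩ := F.exists_triangle Y s (s + 1) rfl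
  obtain ⟨y₁, y₂⟩ := (heart_shift_iff E s Y).1 hY
  have hB₁ : E.ge s B := i₂ s _ hB
  have hA₁ : E.le s A := i₃ s _ hA
  have hA₂ : E.ge s A := by
    rw [ge_iff_isGE]
    exact E.isGE₂ _ (inv_rot_of_distTriang _ hT) s
      ⟨E.ge_antitone (by lia) _ (E.ge_shift s (-1) (s + 1) (by lia) _ hB₁)⟩ ⟨y₂⟩
  have hB₂ : E.le s B := by
    rw [le_iff_isLE]
    exact E.isLE₂ _ (rot_of_distTriang _ hT) s ⟨y₁⟩
      ⟨E.le_monotone (by lia) _ (E.le_shift s 1 (s - 1) (by lia) _ hA₁)⟩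
  have hA' := (heart_shift_iff E s A).2 ⟨hA₁, hA₂⟩
  have hB' := (heart_shift_iff E s B).2 ⟨hB₂, hB₁⟩
  exact ⟨A, B, f, g, shortExactIn_of_distTriang E s f g d hT hA' hY hB',
    ⟨F.le_shift s s 0 (by lia) _ hA, hA'⟩, ⟨F.ge_shift (s + 1) s 1 (by lia) _ hB, hB'⟩,
    (heart_shift_iff F s A).2 ⟨hA, i₁ _ _ hA₂⟩,
    (heart_shift_iff F (s + 1) B).2 ⟨i₄ _ _ hB₂, hB⟩⟩

/-- Every object of the heart of `D` has a right t-tree. -/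
theorem RightTTree.nonempty {D T : TStructure C} (h : D.RightFilterable T) (n : ℕ)
    (hn : D.IsOfType T n 0) (X : C) (hX : D.heart X) : Nonempty (RightTTree h n X) := by
  classical
  have h₀ : (h.basicHeart 0).shift (0 : ℤ) X := by
    have hDT : D.ge 1 ≤ T.ge 1 := fun Z hZ ↦ by
      rw [ge_iff_isGE, T.isGE_iff_orthogonal 0 1 rfl]
      intro W f hW
      exact D.zero' f (hn.1.1 _ hW.le) hZ
    have hg : ∀ m, (h.basic 0).ge m = D.ge m := fun m ↦ by
      rw [h.basic_ge, sub_zero, inf_eq_left, ← D.shift_ge (m - 1) 1 m (by lia),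
        ← T.shift_ge (m - 1) 1 m (by lia)]
      exact fun Z hZ ↦ hDT _ hZ
    refine (heart_shift_iff _ 0 X).2 ⟨?_, ?_⟩
    · exact le_of_ge (h.basic 0) D (hg _).le _ hX.1
    · rw [hg]
      exact hX.2
  have step : ∀ (i s : ℤ) (Y : C), ∃ (A B : C), (h.basicHeart i).shift s Y →
      ∃ (f : A ⟶ Y) (g : Y ⟶ B), ShortExactIn ((h.basicHeart i).shift s) f g ∧
      (h.torsionClass i).shift s A ∧ (h.torsionFreeClass i).shift s B ∧
      (h.basicHeart (i + 1)).shift s A ∧ (h.basicHeart (i + 1)).shift (s + 1) B := by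
    intro i s Y
    by_cases hY : (h.basicHeart i).shift s Y
    · obtain ⟨A, B, r⟩ := h.exists_decomposition i s Y hY
      exact ⟨A, B, fun _ ↦ r⟩
    · exact ⟨Y, Y, fun h' ↦ (hY h').elim⟩
  choose A B hAB using step
  let V : List (Fin 2) → C := fun r ↦ List.rec X
    (fun j r Y ↦ if j = 0 then A r.length (wordDegree r) Y else B r.length (wordDegree r) Y) r
  have hV₀ : ∀ r, V (0 :: r) = A r.length (wordDegree r) (V r) := fun r ↦ rfl
  have hV₁ : ∀ r, V (1 :: r) = B r.length (wordDegree r) (V r) := fun r ↦ rfl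
  have hd : ∀ w : List (Fin 2), wordDegree w.reverse = wordDegree w := fun w ↦ by
    simp [wordDegree]
  have hV : ∀ r, (h.basicHeart r.length).shift (wordDegree r) (V r) := by
    intro r
    induction r with
    | nil => exact h₀
    | cons j r ih =>
      obtain ⟨_, _, _, _, _, a, b⟩ := hAB _ _ _ ih
      have hl : ((j :: r).length : ℤ) = r.length + 1 := by simp
      rw [hl]
      fin_cases j
      · have : wordDegree (0 :: r) = wordDegree r := by simp [wordDegree]
        simpa only [Fin.zero_eta, this, hV₀] using a
      · have : wordDegree (1 :: r) = wordDegree r + 1 := by simp [wordDegree, add_comm]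
        simpa only [Fin.mk_one, this, hV₁] using b
  have key : ∀ w : List (Fin 2), ∃ (f : V (w ++ [0]).reverse ⟶ V w.reverse)
      (g : V w.reverse ⟶ V (w ++ [1]).reverse),
      ShortExactIn ((h.basicHeart w.length).shift (wordDegree w)) f g ∧
      (h.torsionClass w.length).shift (wordDegree w) (V (w ++ [0]).reverse) ∧
      (h.torsionFreeClass w.length).shift (wordDegree w) (V (w ++ [1]).reverse) := by
    intro w
    have r := hAB _ _ _ (hV w.reverse)
    rw [List.reverse_concat, List.reverse_concat, hV₀, hV₁]
    rw [List.length_reverse, hd] at r ⊢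
    obtain ⟨f, g, r₁, r₂, r₃, -⟩ := r
    exact ⟨f, g, r₁, r₂, r₃⟩
  choose f g h₁ h₂ h₃ using key
  exact ⟨⟨fun w ↦ V w.reverse, Iso.refl _, fun w _ ↦ f w, fun w _ ↦ g w, fun w _ ↦ h₁ w,
    fun w _ ↦ h₂ w, fun w _ ↦ h₃ w⟩⟩

end Existence

end CategoryTheory.Triangulated.TStructure

/-! The coordinate that controls everything is the heart containing a vertex. Since `X_i` lies in
`H_{i+1}` and `Y_i` in `H_{i+1}[-1]`, a word of length `ℓ` and degree `s` labels an object of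
`H_ℓ[-s]` (`vertex_mem`). Type `(n, 0)` gives `D_0 = D`, which places the root, and `D_ℓ^{≤ s} ⊆
T^{≤ n-ℓ+s}` for `ℓ ≤ n`; with `D_ℓ^{≥ s} ⊆ T^{≥ s}` this is the first claim.

For the extreme cohomologies, each branching is a triangle `X_{w0} → X_w → X_{w1} →`. Here `X_{w1}`
lies in `T^{≥ s+1}`, so `X_w` and `X_{w0}` have the same `H^s`; and `X_{w0}` lies in `T^{≤
n-ℓ-1+s}`, so `X_w` and `X_{w1}` have the same `H^{n-ℓ+s}`. Iterating reaches a leaf, which is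
concentrated in a single `T`-degree.

The tree only provides categorical short exact sequences in shifted hearts. They are compared with
truncation triangles of `D_{ℓ+1}` by uniqueness of the torsion decomposition, which uses that
shifted hearts are balanced. -/

namespace CategoryTheory.Triangulated.TStructure

section TTreeCohomology

variable {C : Type u} [Category.{v} C] [Preadditive C] [HasZeroObject C] [HasShift C ℤ]
  [∀ n : ℤ, (shiftFunctor C n).Additive] [Pretriangulated C]

/-! ### Short exact sequences in shifted hearts -/

/-- The cone of `f` lives in degrees `s - 1` and `s`, where its cohomologies play the roles of
kernel and cokernel of `f`. The two cancellation hypotheses kill them, so the cone vanishes. -/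
lemma isIso_of_mono_of_epi_shifted_heart (E : TStructure C) (s : ℤ) {X Y : C} (f : X ⟶ Y)
    (hX : E.heart.shift s X) (hY : E.heart.shift s Y)
    (hm : ∀ (A : C) (k : A ⟶ X), E.heart.shift s A → k ≫ f = 0 → k = 0)
    (he : ∀ (A : C) (k : Y ⟶ A), E.heart.shift s A → f ≫ k = 0 → k = 0) : IsIso f := by
  obtain ⟨xl, xg⟩ := (heart_shift_iff E s X).1 hX
  obtain ⟨yl, yg⟩ := (heart_shift_iff E s Y).1 hY
  rw [le_iff_isLE] at xl yl
  rw [ge_iff_isGE] at xg yg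
  obtain ⟨Z, g, d, hT⟩ := distinguished_cocone_triangle f
  have hX₁ : E.IsLE (X⟦(1 : ℤ)⟧) (s - 1) := E.isLE_shift X s 1 (s - 1)
  have hX₁' : E.IsGE (X⟦(1 : ℤ)⟧) (s - 1) := E.isGE_shift X s 1 (s - 1)
  have hX₁'' : E.IsLE (X⟦(1 : ℤ)⟧) s := E.isLE_of_le _ (s - 1) s
  have hY₁ : E.IsGE (Y⟦(-1 : ℤ)⟧) (s + 1) := E.isGE_shift Y s (-1) (s + 1)
  have hY' : E.IsGE Y (s - 1) := E.isGE_of_ge _ (s - 1) s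
  have zl : E.IsLE Z s := E.isLE₂ _ (rot_of_distTriang _ hT) s yl hX₁''
  have zg : E.IsGE Z (s - 1) := E.isGE₂ _ (rot_of_distTriang _ hT) (s - 1) hY' hX₁'
  -- The truncation `b : Z ⟶ B` has target in the shifted heart. As `f` is epi there, `g ≫ b = 0`,
  -- so `b` factors through `X⟦1⟧`, which lies in degrees `≤ s - 1`; hence `b = 0`.
  have zl' : E.IsLE Z (s - 1) := by
    obtain ⟨A, B, hA, hB, a, b, c, hT'⟩ := E.exists_triangle Z (s - 1) s (by lia)
    rw [le_iff_isLE] at hA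
    rw [ge_iff_isGE] at hB
    have hA₁ : E.IsLE (A⟦(1 : ℤ)⟧) (s - 2) := E.isLE_shift A (s - 1) 1 (s - 2)
    have hA₂ : E.IsLE (A⟦(1 : ℤ)⟧) s := E.isLE_of_le _ (s - 2) s
    have hB' : E.IsLE B s := E.isLE₂ _ (rot_of_distTriang _ hT') s zl hA₂
    have h₁ : g ≫ b = 0 := he B _ ((heart_shift_iff E s B).2 ⟨hB'.le, hB.ge⟩) (by
      rw [← Category.assoc]
      exact (congrArg (· ≫ b) (comp_distTriang_mor_zero₁₂ _ hT)).trans zero_comp)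
    obtain ⟨k, hk⟩ := Triangle.yoneda_exact₃ _ hT b h₁
    have hb : b = 0 := by
      rw [hk, show k = 0 from E.zero (X := X⟦(1 : ℤ)⟧) k (s - 1) s, comp_zero]
      rfl
    rw [E.isLE_iff_orthogonal (s - 1) s (by lia)]
    intro W e hW
    obtain ⟨l, hl⟩ := Triangle.yoneda_exact₂ _ hT' e (E.zero (X := A) (a ≫ e) (s - 1) s)
    rw [hl]
    exact (congrArg (· ≫ l) hb).trans zero_comp
  -- Dual argument on `Z⟦-1⟧ ⟶ X ⟶ Y`: the truncation `a : A ⟶ Z⟦-1⟧` dies in `X` because `f` is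
  -- mono, hence factors through `Y⟦-1⟧`, which lies in degrees `≥ s + 1`.
  have zg' : E.IsGE (Z⟦(-1 : ℤ)⟧) (s + 1) := by
    have hZ₁ : E.IsGE (Z⟦(-1 : ℤ)⟧) s := E.isGE_shift Z (s - 1) (-1) s
    obtain ⟨A, B, hA, hB, a, b, c, hT'⟩ := E.exists_triangle (Z⟦(-1 : ℤ)⟧) s (s + 1) rfl
    rw [le_iff_isLE] at hA
    rw [ge_iff_isGE] at hB
    have hB₁ : E.IsGE (B⟦(-1 : ℤ)⟧) (s + 2) := E.isGE_shift B (s + 1) (-1) (s + 2)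
    have hB₂ : E.IsGE (B⟦(-1 : ℤ)⟧) s := E.isGE_of_ge _ s (s + 2)
    have hA' : E.IsGE A s := E.isGE₂ _ (inv_rot_of_distTriang _ hT') s hB₂ hZ₁
    have hT₁ := inv_rot_of_distTriang _ hT
    have hT₂ := inv_rot_of_distTriang _ hT₁
    let m : Z⟦(-1 : ℤ)⟧ ⟶ X := (Triangle.mk f g d).invRotate.mor₁
    have hm' : m ≫ f = 0 := comp_distTriang_mor_zero₁₂ _ hT₁
    have h₁ : a ≫ m = 0 := hm A _ ((heart_shift_iff E s A).2 ⟨hA.le, hA'.ge⟩) (by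
      rw [Category.assoc, hm', comp_zero])
    obtain ⟨k, hk⟩ := Triangle.coyoneda_exact₂ _ hT₂ a h₁
    have ha : a = 0 := by
      rw [hk]
      have : k = 0 := E.zero (Y := Y⟦(-1 : ℤ)⟧) k s (s + 1)
      rw [this, zero_comp]
      rfl
    rw [E.isGE_iff_orthogonal s (s + 1) rfl]
    intro V q hV
    obtain ⟨l, hl⟩ := Triangle.coyoneda_exact₂ _ hT' q (E.zero (Y := B) (q ≫ b) s (s + 1))
    rw [hl]
    exact (congrArg (l ≫ ·) ha).trans comp_zero
  have := E.isGE_of_shift Z s (-1) (s + 1)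
  exact (Triangle.isZero₃_iff_isIso₁ _ hT).1 (E.isZero Z (s - 1) s)

instance balanced_shifted_heart (E : TStructure C) (s : ℤ) :
    Balanced (E.heart.shift s).FullSubcategory where
  isIso_of_mono_of_epi {X Y} f _ _ := by
    have : IsIso ((E.heart.shift s).ι.map f) := by
      refine isIso_of_mono_of_epi_shifted_heart E s f.hom X.property Y.property ?_ ?_
      · intro A k hA hk
        have h₀ : (ObjectProperty.homMk k : (⟨A, hA⟩ : (E.heart.shift s).FullSubcategory) ⟶ X) = 0 :=
          zero_of_comp_mono f (ObjectProperty.hom_ext _ hk)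
        exact congrArg (fun z ↦ z.hom) h₀
      · intro A k hA hk
        have h₀ : (ObjectProperty.homMk k : Y ⟶ (⟨A, hA⟩ : (E.heart.shift s).FullSubcategory)) = 0 :=
          zero_of_epi_comp f (ObjectProperty.hom_ext _ hk)
        exact congrArg (fun z ↦ z.hom) h₀
    exact isIso_of_reflects_iso f (E.heart.shift s).ι

/-- Two short exact sequences with the same middle term, in a shifted heart, have isomorphic
outer terms as soon as the mixed compositions vanish. -/
lemma ShortExactIn.nonempty_iso {E : TStructure C} {s : ℤ} {A A' Y B B' : C}
    {f : A ⟶ Y} {g : Y ⟶ B} {f' : A' ⟶ Y} {g' : Y ⟶ B'}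
    (H : ShortExactIn (E.heart.shift s) f g) (H' : ShortExactIn (E.heart.shift s) f' g')
    (w : f ≫ g' = 0) (w' : f' ≫ g = 0) : Nonempty (A ≅ A') ∧ Nonempty (B ≅ B') := by
  obtain ⟨hA, hY, hB, z, S⟩ := H
  obtain ⟨hA', _, hB', z', S'⟩ := H'
  let P := E.heart.shift s
  let F : (⟨A, hA⟩ : P.FullSubcategory) ⟶ ⟨Y, hY⟩ := ObjectProperty.homMk f
  let F' : (⟨A', hA'⟩ : P.FullSubcategory) ⟶ ⟨Y, hY⟩ := ObjectProperty.homMk f'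
  let G : (⟨Y, hY⟩ : P.FullSubcategory) ⟶ ⟨B, hB⟩ := ObjectProperty.homMk g
  let G' : (⟨Y, hY⟩ : P.FullSubcategory) ⟶ ⟨B', hB'⟩ := ObjectProperty.homMk g'
  have W : F ≫ G' = 0 := ObjectProperty.hom_ext _ w
  have W' : F' ≫ G = 0 := ObjectProperty.hom_ext _ w'
  have : Mono F := S.mono_f
  have : Mono F' := S'.mono_f
  have : Epi G := S.epi_g
  have : Epi G' := S'.epi_g
  -- Balancedness enters here: it makes the mono of a short exact sequence a kernel and the epi a
  -- cokernel.
  obtain ⟨u, hu⟩ : ∃ u, u ≫ F' = F := ⟨_, (KernelFork.IsLimit.lift' S'.fIsKernel F W).2⟩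
  obtain ⟨u', hu'⟩ : ∃ u, u ≫ F = F' := ⟨_, (KernelFork.IsLimit.lift' S.fIsKernel F' W').2⟩
  obtain ⟨t, ht⟩ : ∃ t, G ≫ t = G' := ⟨_, (CokernelCofork.IsColimit.desc' S.gIsCokernel G' W).2⟩
  obtain ⟨t', ht'⟩ : ∃ t, G' ≫ t = G :=
    ⟨_, (CokernelCofork.IsColimit.desc' S'.gIsCokernel G W').2⟩
  let e : (⟨A, hA⟩ : P.FullSubcategory) ≅ ⟨A', hA'⟩ :=
    ⟨u, u', by rw [← cancel_mono F, Category.assoc, hu', hu, Category.id_comp],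
      by rw [← cancel_mono F', Category.assoc, hu, hu', Category.id_comp]⟩
  let e' : (⟨B, hB⟩ : P.FullSubcategory) ≅ ⟨B', hB'⟩ :=
    ⟨t, t', by rw [← cancel_epi G, ← Category.assoc, ht, ht', Category.comp_id],
      by rw [← cancel_epi G', ← Category.assoc, ht', ht, Category.comp_id]⟩
  exact ⟨⟨P.ι.mapIso e⟩, ⟨P.ι.mapIso e'⟩⟩

/-! ### Degrees of words -/

lemma wordDegree_append (w w' : List (Fin 2)) :
    wordDegree (w ++ w') = wordDegree w + wordDegree w' := by
  simp [wordDegree]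

lemma wordDegree_nonneg (w : List (Fin 2)) : 0 ≤ wordDegree w := Int.natCast_nonneg _

lemma wordDegree_le_length (w : List (Fin 2)) : wordDegree w ≤ w.length := by
  induction w with
  | nil => simp [wordDegree]
  | cons i w ih =>
    have h := wordDegree_append [i] w
    have hi : wordDegree [i] ≤ 1 := by fin_cases i <;> simp [wordDegree]
    rw [List.singleton_append] at h
    rw [h, List.length_cons]
    push_cast
    lia

/-! ### Right basic t-structures compared with each other and with `D`, `T` -/

namespace RightFilterable

variable {D T : TStructure C} (h : D.RightFilterable T)

lemma basic_ge_mono (i m : ℤ) : (h.basic i).ge m ≤ (h.basic (i + 1)).ge m := by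
  rw [h.basic_ge, h.basic_ge]
  exact inf_le_inf_right _ (D.ge_antitone (by lia))

lemma basic_succ_ge_le (i m : ℤ) : (h.basic (i + 1)).ge (m + 1) ≤ (h.basic i).ge m := by
  rw [h.basic_ge, h.basic_ge]
  exact inf_le_inf (D.ge_antitone (by lia)) (T.ge_antitone (by lia))

lemma basic_succ_le_le (i m : ℤ) : (h.basic (i + 1)).le m ≤ (h.basic i).le m :=
  le_of_ge _ _ (h.basic_ge_mono i _)

lemma basic_le_le_succ (i m : ℤ) : (h.basic i).le m ≤ (h.basic (i + 1)).le (m + 1) :=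
  le_of_ge _ _ (h.basic_succ_ge_le i _)

/-- On co-aisles, the gap `n` says `T^{≥ 1} ⊆ D^{≥ 1-n}`. Shifting by `n - i + m` gives the
`D`-condition defining `D_i^{≥ m+1}`; the `T`-condition is where `i ≤ n` is needed. -/
lemma basic_le_le (n : ℕ) (hn : D.IsOfType T n 0) (i m : ℤ) (hi : i ≤ n) :
    (h.basic i).le m ≤ T.le (n - i + m) := by
  have hDT : T.ge 1 ≤ D.ge (1 - n) := fun Z hZ ↦ by
    rw [ge_iff_isGE, D.isGE_iff_orthogonal (-n) (1 - n) (by lia)]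
    intro W f hW
    exact T.zero' f (hn.2.1 _ hW.le) hZ
  refine le_of_ge _ _ fun Z hZ ↦ ?_
  rw [h.basic_ge]
  refine ⟨?_, T.ge_antitone (by lia) _ hZ⟩
  rw [← T.shift_ge (n - i + m) 1 _ rfl] at hZ
  rw [← D.shift_ge (n - i + m) (1 - n) (m + 1 - i) (by lia)]
  exact hDT _ hZ

lemma basic_ge_le (i m : ℤ) : (h.basic i).ge m ≤ T.ge m := by
  rw [h.basic_ge]
  exact inf_le_right

lemma basic_zero_ge (n : ℕ) (hn : D.IsOfType T n 0) (m : ℤ) : (h.basic 0).ge m = D.ge m := by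
  have hDT : D.ge 1 ≤ T.ge 1 := fun Z hZ ↦ by
    rw [ge_iff_isGE, T.isGE_iff_orthogonal 0 1 rfl]
    intro W f hW
    exact D.zero' f (hn.1.1 _ hW.le) hZ
  rw [h.basic_ge, sub_zero, inf_eq_left, ← D.shift_ge (m - 1) 1 m (by lia),
    ← T.shift_ge (m - 1) 1 m (by lia)]
  exact fun Z hZ ↦ hDT _ hZ

lemma heart_le_basicHeart_zero (n : ℕ) (hn : D.IsOfType T n 0) : D.heart ≤ h.basicHeart 0 :=
  fun _ hX ↦ ⟨le_of_ge (h.basic 0) D (h.basic_zero_ge n hn _).le _ hX.1,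
    (h.basic_zero_ge n hn 0).symm ▸ hX.2⟩

lemma shift_torsionClass_iff (i s : ℤ) (Y : C) :
    (h.torsionClass i).shift s Y ↔
      (h.basic (i + 1)).le s Y ∧ (h.basicHeart i).shift s Y := by
  rw [← (h.basic (i + 1)).shift_le s 0 s (by lia)]
  rfl

lemma shift_torsionFreeClass_iff (i s : ℤ) (Y : C) :
    (h.torsionFreeClass i).shift s Y ↔
      (h.basic (i + 1)).ge (s + 1) Y ∧ (h.basicHeart i).shift s Y := by
  rw [← (h.basic (i + 1)).shift_ge s 1 (s + 1) rfl]
  rfl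

lemma shift_torsionClass_le (i s : ℤ) :
    (h.torsionClass i).shift s ≤ (h.basicHeart (i + 1)).shift s := fun Y hY ↦ by
  rw [shift_torsionClass_iff] at hY
  obtain ⟨h₁, h₂⟩ := hY
  exact (heart_shift_iff _ s Y).2
    ⟨h₁, h.basic_ge_mono i s _ ((heart_shift_iff _ s Y).1 h₂).2⟩

lemma shift_torsionFreeClass_le (i s : ℤ) :
    (h.torsionFreeClass i).shift s ≤ (h.basicHeart (i + 1)).shift (s + 1) := fun Y hY ↦ by
  rw [shift_torsionFreeClass_iff] at hY
  obtain ⟨h₁, h₂⟩ := hY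
  exact (heart_shift_iff _ (s + 1) Y).2
    ⟨h.basic_le_le_succ i s _ ((heart_shift_iff _ s Y).1 h₂).1, h₁⟩

/-- A short exact sequence in a shifted right basic heart which is a decomposition for the shifted
torsion pair has the outer terms of a distinguished triangle. -/
lemma exists_distTriang_of_shortExactIn (i s : ℤ) {A Y B : C} (f : A ⟶ Y) (g : Y ⟶ B)
    (H : ShortExactIn ((h.basicHeart i).shift s) f g)
    (hA : (h.torsionClass i).shift s A) (hB : (h.torsionFreeClass i).shift s B) :
    ∃ (A' B' : C) (_ : A ≅ A') (_ : B ≅ B') (a : A' ⟶ Y) (b : Y ⟶ B')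
      (c : B' ⟶ A'⟦(1 : ℤ)⟧), Triangle.mk a b c ∈ distTriang C := by
  obtain ⟨hA₁, -⟩ := (h.shift_torsionClass_iff i s A).1 hA
  obtain ⟨hB₁, -⟩ := (h.shift_torsionFreeClass_iff i s B).1 hB
  have hY : (h.basicHeart i).shift s Y := H.2.1
  obtain ⟨y₁, y₂⟩ := (heart_shift_iff _ s Y).1 hY
  set E := h.basic i
  set F := h.basic (i + 1)
  -- The truncation triangle for `D_{i+1}` is a second decomposition of `Y` in `H_i[-s]`.
  -- Orthogonality for `D_{i+1}` kills both mixed compositions, so the outer terms agree.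
  obtain ⟨A', B', hA', hB', a, b, c, hT⟩ := F.exists_triangle Y s (s + 1) rfl
  have hB₂ : E.ge s B' := h.basic_succ_ge_le i s _ hB'
  have hA₂ : E.le s A' := h.basic_succ_le_le i s _ hA'
  have hA₃ : E.ge s A' := by
    rw [ge_iff_isGE]
    exact E.isGE₂ _ (inv_rot_of_distTriang _ hT) s
      ⟨E.ge_antitone (by lia) _ (E.ge_shift s (-1) (s + 1) (by lia) _ hB₂)⟩ ⟨y₂⟩
  have hB₃ : E.le s B' := by
    rw [le_iff_isLE]
    exact E.isLE₂ _ (rot_of_distTriang _ hT) s ⟨y₁⟩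
      ⟨E.le_monotone (by lia) _ (E.le_shift s 1 (s - 1) (by lia) _ hA₂)⟩
  have H' := shortExactIn_of_distTriang E s a b c hT ((heart_shift_iff E s A').2 ⟨hA₂, hA₃⟩) hY
    ((heart_shift_iff E s B').2 ⟨hB₃, hB₂⟩)
  have hz : ∀ {U V : C} (k : U ⟶ V), F.le s U → F.ge (s + 1) V → k = 0 := fun k hU hV ↦
    F.zero_of_isLE_of_isGE k s (s + 1) (by lia) ⟨hU⟩ ⟨hV⟩
  obtain ⟨⟨e⟩, ⟨e'⟩⟩ := ShortExactIn.nonempty_iso (E := E) H H' (hz _ hA₁ hB') (hz _ hA' hB₁)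
  exact ⟨A', B', e, e', a, b, c, hT⟩

end RightFilterable

lemma interval_le_interval (T : TStructure C) {a b a' b' : ℤ} (ha : a' ≤ a) (hb : b ≤ b') :
    T.interval a b ≤ T.interval a' b' :=
  inf_le_inf (T.ge_antitone ha) (T.le_monotone hb)

/-! ### Extreme cohomology along a triangle -/

section Cohomology

variable (T : TStructure C)

lemma nonempty_tCohomology_iso_shift (s : ℤ) (Y : C) (hY : T.interval s s Y) :
    Nonempty ((T.tCohomology s).obj Y ≅ Y⟦s⟧) := by
  have h₁ : T.IsGE (Y⟦s⟧) 0 := ⟨T.ge_shift s s 0 (by lia) _ hY.1⟩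
  have h₂ : T.IsLE (Y⟦s⟧) 0 := ⟨T.le_shift s s 0 (by lia) _ hY.2⟩
  exact ⟨(T.truncGE 0).mapIso (asIso ((T.truncLEι 0).app (Y⟦s⟧))) ≪≫
    (asIso ((T.truncGEπ 0).app (Y⟦s⟧))).symm⟩

variable [IsTriangulated C]

lemma nonempty_tCohomology_iso_of_ge₃ (s : ℤ) {A Y B : C} {a : A ⟶ Y} {b : Y ⟶ B}
    {c : B ⟶ A⟦(1 : ℤ)⟧} (hT : Triangle.mk a b c ∈ distTriang C) (hB : T.ge (s + 1) B) :
    Nonempty ((T.tCohomology s).obj A ≅ (T.tCohomology s).obj Y) := by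
  have hT' := Triangle.shift_distinguished _ hT s
  have := T.isIso₁_truncLE_map_of_isGE _ hT' 0 1 rfl ⟨T.ge_shift (s + 1) s 1 rfl _ hB⟩
  exact ⟨(T.truncGE 0).mapIso (@asIso _ _ _ _ _ this)⟩

/-- After shifting by `s`, the first term lies in degrees `≤ -1`, so `τ^{≥ 0}` inverts the second
map. Since `tCohomology` applies `τ^{≤ 0}` first, the bound on `Y`, inherited by `B`, is what makes
that truncation harmless. -/
lemma nonempty_tCohomology_iso_of_le₁ (s : ℤ) {A Y B : C} {a : A ⟶ Y} {b : Y ⟶ B}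
    {c : B ⟶ A⟦(1 : ℤ)⟧} (hT : Triangle.mk a b c ∈ distTriang C) (hA : T.le (s - 1) A)
    (hY : T.le s Y) :
    Nonempty ((T.tCohomology s).obj Y ≅ (T.tCohomology s).obj B) := by
  have hT' := Triangle.shift_distinguished _ hT s
  have hA' : T.IsLE (A⟦s⟧) (-1) := ⟨T.le_shift (s - 1) s (-1) (by lia) _ hA⟩
  have hA₁ : T.IsLE (A⟦s⟧⟦(1 : ℤ)⟧) (-2) := T.isLE_shift _ (-1) 1 (-2)
  have hA₂ : T.IsLE (A⟦s⟧⟦(1 : ℤ)⟧) 0 := T.isLE_of_le _ (-2) 0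
  have hY' : T.IsLE (Y⟦s⟧) 0 := ⟨T.le_shift s s 0 (by lia) _ hY⟩
  have hB' : T.IsLE (B⟦s⟧) 0 := T.isLE₂ _ (rot_of_distTriang _ hT') 0 hY' hA₂
  have := T.isIso₂_truncGE_map_of_isLE _ hT' (-1) 0 rfl hA'
  exact ⟨(T.truncGE 0).mapIso (asIso ((T.truncLEι 0).app (Y⟦s⟧))) ≪≫
    @asIso _ _ _ _ _ this ≪≫
    (T.truncGE 0).mapIso (asIso ((T.truncLEι 0).app (B⟦s⟧))).symm⟩

end Cohomology

/-! ### Location and extreme cohomology of the vertices -/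

namespace RightTTree

variable {D T : TStructure C} {h : D.RightFilterable T} {n : ℕ} {X : C}

lemma exists_distTriang (tree : RightTTree h n X) (w : List (Fin 2)) (hw : w.length < n) :
    ∃ (A B : C) (_ : tree.vertex (w ++ [0]) ≅ A) (_ : tree.vertex (w ++ [1]) ≅ B)
      (a : A ⟶ tree.vertex w) (b : tree.vertex w ⟶ B) (c : B ⟶ A⟦(1 : ℤ)⟧),
      Triangle.mk a b c ∈ distTriang C :=
  h.exists_distTriang_of_shortExactIn _ _ _ _ (tree.shortExact w hw) (tree.torsion w hw)
    (tree.torsionFree w hw)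

lemma wordDegree_concat_zero (w : List (Fin 2)) : wordDegree (w ++ [0]) = wordDegree w := by
  simp [wordDegree]

lemma wordDegree_concat_one (w : List (Fin 2)) : wordDegree (w ++ [1]) = wordDegree w + 1 := by
  simp [wordDegree]

/-- Only the last letter matters: torsion keeps the shift and torsion-free raises it by one, as the
heart index increases. This also covers leaves, which have no exact sequence of their own. -/
lemma vertex_mem (tree : RightTTree h n X) (hn : D.IsOfType T n 0) (hX : D.heart X)
    (w : List (Fin 2)) (hw : w.length ≤ n) :
    (h.basicHeart w.length).shift (wordDegree w) (tree.vertex w) := by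
  induction w using List.reverseRecOn with
  | nil =>
    have h₀ := h.heart_le_basicHeart_zero n hn _ (D.heart.prop_of_iso tree.root.symm hX)
    exact (heart_shift_iff _ 0 _).2 h₀
  | append_singleton w i _ =>
    rw [List.length_append, List.length_singleton] at hw ⊢
    push_cast
    fin_cases i
    · exact wordDegree_concat_zero w ▸ h.shift_torsionClass_le _ _ _ (tree.torsion w hw)
    · exact wordDegree_concat_one w ▸ h.shift_torsionFreeClass_le _ _ _ (tree.torsionFree w hw)

lemma vertex_mem_interval (tree : RightTTree h n X) (hn : D.IsOfType T n 0) (hX : D.heart X)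
    (w : List (Fin 2)) (hw : w.length ≤ n) :
    T.interval (wordDegree w) (n - w.length + wordDegree w) (tree.vertex w) := by
  obtain ⟨h₁, h₂⟩ := (heart_shift_iff _ _ _).1 (tree.vertex_mem hn hX w hw)
  exact ⟨h.basic_ge_le _ _ _ h₂, h.basic_le_le n hn _ _ (by exact_mod_cast hw) _ h₁⟩

variable [IsTriangulated C]

lemma nonempty_tCohomology_iso_zeros (tree : RightTTree h n X) (hn : D.IsOfType T n 0)
    (hX : D.heart X) (m : ℕ) (w : List (Fin 2)) (hw : w.length + m = n) :
    Nonempty ((T.tCohomology (wordDegree w)).obj (tree.vertex w) ≅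
      (tree.vertex (w ++ List.replicate m 0))⟦wordDegree w⟧) := by
  -- `m` is the distance to the leaves; at `m = 0` the interval collapses to `[s, s]`.
  induction m generalizing w with
  | zero =>
    have hY := tree.vertex_mem_interval hn hX w (by lia)
    rw [show (n : ℤ) - w.length + wordDegree w = wordDegree w by lia] at hY
    rw [List.replicate_zero, List.append_nil]
    exact T.nonempty_tCohomology_iso_shift _ _ hY
  | succ m ih =>
    have hlen : (w ++ [1]).length ≤ n := by simp; lia
    obtain ⟨A, B, e, e', a, b, c, hT⟩ := tree.exists_distTriang w (by lia)
    have hB := (tree.vertex_mem_interval hn hX (w ++ [1]) hlen).1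
    rw [wordDegree_concat_one] at hB
    obtain ⟨i₁⟩ := T.nonempty_tCohomology_iso_of_ge₃ _ hT ((T.ge _).prop_of_iso e' hB)
    obtain ⟨i₂⟩ := ih (w ++ [0]) (by simp; lia)
    rw [wordDegree_concat_zero, List.append_assoc, List.singleton_append,
      ← List.replicate_succ] at i₂
    exact ⟨i₁.symm ≪≫ (T.tCohomology _).mapIso e.symm ≪≫ i₂⟩

lemma nonempty_tCohomology_iso_ones (tree : RightTTree h n X) (hn : D.IsOfType T n 0)
    (hX : D.heart X) (m : ℕ) (w : List (Fin 2)) (hw : w.length + m = n) :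
    Nonempty ((T.tCohomology (m + wordDegree w)).obj (tree.vertex w) ≅
      (tree.vertex (w ++ List.replicate m 1))⟦m + wordDegree w⟧) := by
  induction m generalizing w with
  | zero =>
    have hY := tree.vertex_mem_interval hn hX w (by lia)
    rw [show (n : ℤ) - w.length + wordDegree w = wordDegree w by lia] at hY
    rw [List.replicate_zero, List.append_nil, Nat.cast_zero, zero_add]
    exact T.nonempty_tCohomology_iso_shift _ _ hY
  | succ m ih =>
    have hlen : (w ++ [0]).length ≤ n := by simp; lia
    obtain ⟨A, B, e, e', a, b, c, hT⟩ := tree.exists_distTriang w (by lia)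
    have hA := (tree.vertex_mem_interval hn hX (w ++ [0]) hlen).2
    have hY := (tree.vertex_mem_interval hn hX w (by lia)).2
    rw [wordDegree_concat_zero, List.length_append, List.length_singleton] at hA
    replace hA := T.le_monotone
      (show _ ≤ ((m + 1 : ℕ) : ℤ) + wordDegree w - 1 by lia) _ hA
    rw [show (n : ℤ) - w.length + wordDegree w = ((m + 1 : ℕ) : ℤ) + wordDegree w by lia] at hY
    obtain ⟨i₁⟩ := T.nonempty_tCohomology_iso_of_le₁ _ hT ((T.le _).prop_of_iso e hA) hY
    obtain ⟨i₂⟩ := ih (w ++ [1]) (by simp; lia)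
    -- Appending a one lowers `m` by one and raises the degree by one, so the cohomological index
    -- stays fixed along this branch.
    rw [wordDegree_concat_one, List.append_assoc, List.singleton_append,
      ← List.replicate_succ, show (m : ℤ) + (wordDegree w + 1) =
        ((m + 1 : ℕ) : ℤ) + wordDegree w by lia] at i₂
    exact ⟨i₁ ≪≫ (T.tCohomology _).mapIso e'.symm ≪≫ i₂⟩

end RightTTree

end TTreeCohomology

end CategoryTheory.Triangulated.TStructure

theorem mainTheorem9 {C : Type u} [Category.{v} C] [Preadditive C] [HasZeroObject C]
    [HasShift C ℤ] [∀ n : ℤ, (shiftFunctor C n).Additive] [Pretriangulated C] [IsTriangulated C]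
    (D T : TStructure C) (h : D.RightFilterable T) (n : ℕ) (hn : D.IsOfType T n 0)
    (X : C) (hX : D.heart X) (tree : TStructure.RightTTree h n X)
    (l : ℕ) (hl : l ≤ n) (w : List (Fin 2)) (hw : w.length = l)
    (s : ℤ) (hs : s = TStructure.wordDegree w) :
    (T.interval s (n - l + s) (tree.vertex w) ∧
      T.interval s (n - l + s) ≤ T.interval 0 n) ∧
    Nonempty ((T.tCohomology s).obj (tree.vertex w) ≅
      (tree.vertex (w ++ List.replicate (n - l) 0))⟦s⟧) ∧
    Nonempty ((T.tCohomology (n - l + s)).obj (tree.vertex w) ≅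
      (tree.vertex (w ++ List.replicate (n - l) 1))⟦(n - l + s : ℤ)⟧) := by
  subst hw hs
  have hd₀ := TStructure.wordDegree_nonneg w
  have hd₁ := TStructure.wordDegree_le_length w
  refine ⟨⟨tree.vertex_mem_interval hn hX w hl, T.interval_le_interval hd₀ (by lia)⟩,
    tree.nonempty_tCohomology_iso_zeros hn hX _ w (by lia), ?_⟩
  have H := tree.nonempty_tCohomology_iso_ones hn hX (n - w.length) w (by lia)
  rwa [Nat.cast_sub hl] at H
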